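/- **Setting.** Let $(X,d_X)$ be a compact geodesic metric space (any two points are joined by a path whose length equals their distance), and let $\mu$ be a Borel probability measure on $X$ that is $L$-doubling: all open balls $B(x,\rho)$, $\rho>0$, have finite positive measure and $\mu(B(x,2\rho))\le L\,\mu(B(x,\rho))$. Let $n$ points, indexed by a node set $V$, be sampled i.i.d. from $\mu$, and let $r>0$. The true graph $G^*$ is the simple graph on $V$ in which distinct $u,v$ are adjacent if and only if $d_X(u,v)\le r$. The observed graph $\widehat G=G(r,p,q)$, with $p,q\in[0,1]$, arises from $G^*$ by deleting each edge with probability $p$ and inserting each non-edge with probability $q$, all independently given the points. For an edge $(u,v)$ of a graph $G$ let $\rho_{u,v}(G)=|N_G(u)\cap N_G(v)|/|N_G(u)\cup N_G(v)|$ be its Jaccard index, where $N_G$ denotes neighbor sets. The $\tau$-Jaccard-filtered graph $\widetilde G_\tau$ has node set $V$ and exactly those edges $(u,v)$ of $\widehat G$ with $\rho_{u,v}(\widehat G)\ge\tau$. For a graph $G$ on $V$ let $d_G$ be its shortest-path metric (with value $\infty$ between different components). Assumption-R for $n$, $r$ and $s$ says that $\mu(B(x,r/2))\ge s$ for every $x\in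 X$, where $s\ge \frac{12\ln n}{n-2}$. **Theorem.** There is a universal constant $\kappa>0$ such that the following holds. Let $(s_n)$ be a real sequence with $s_n n=\omega(\ln n)$. Then there is a sequence $\varepsilon_n\to0$, i.e. $\varepsilon_n=o(1)$, depending only on $(s_n)$, such that for all sufficiently large $n$ (depending only on $(s_n)$), all $X$, $\mu$, $L$, $r$, $p$, $q$ as above and all real $c$, $\tau$ (any of which may vary with $n$): if Assumption-R holds for $n$, $r$ and $s=s_n$, if $p\le\frac14$ and $q\le\min\{\frac18,\,c\,s_n\}$, and if $$\frac{(c+2)q}{1-p}+\varepsilon_n<\tau<\frac{(1-p)^2}{\bigl(10+\frac{5}{3\ln n}+20c\bigr)L^2},$$ then with probability at least $1-n^{-\kappa}$ the metric $d_{\widetilde G_\tau}$ is a $2$-approximation of $d_{G^*}$, that is, $\frac12 d_{G^*}(u,v)\le d_{\widetilde G_\tau}(u,v)\le 2\,d_{G^*}(u,v)$ for all $u,v\in V$. -/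

import Mathlib

open MeasureTheory Filter Topology

noncomputable section

namespace JaccardFiltering

/-- A geodesic metric space: any two points `x`, `y` are joined by a path of length `dist x y`,
here parametrized by arc length. -/
def IsGeodesicSpace (X : Type*) [MetricSpace X] : Prop :=
  ∀ x y : X, ∃ γ : ℝ → X, γ 0 = x ∧ γ (dist x y) = y ∧
    ∀ a ∈ Set.Icc (0 : ℝ) (dist x y), ∀ b ∈ Set.Icc (0 : ℝ) (dist x y),
      dist (γ a) (γ b) = |a - b|

/-- `μ` is an `L`-doubling measure: open balls have finite positive measure, and doubling the
radius multiplies the measure by at most `L`. -/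
structure IsDoublingMeasure {X : Type*} [MetricSpace X] [MeasurableSpace X]
    (μ : Measure X) (L : ℝ) : Prop where
  ball_pos : ∀ (x : X) (ρ : ℝ), 0 < ρ → 0 < μ (Metric.ball x ρ)
  ball_lt_top : ∀ (x : X) (ρ : ℝ), 0 < ρ → μ (Metric.ball x ρ) < ⊤
  doubling : ∀ (x : X) (ρ : ℝ), 0 < ρ →
    μ.real (Metric.ball x (2 * ρ)) ≤ L * μ.real (Metric.ball x ρ)

/-- Assumption-R for `n` sample points: every open ball of radius `r / 2` has measure at least `s`,
where `s ≥ 12 ln n / (n - 2)`. It is only used for `n ≥ 3`. -/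
structure AssumptionR {X : Type*} [MetricSpace X] [MeasurableSpace X]
    (μ : Measure X) (r : ℝ) (n : ℕ) (s : ℝ) : Prop where
  le_measure_ball : ∀ x : X, s ≤ μ.real (Metric.ball x (r / 2))
  le_s : 12 * Real.log n / ((n : ℝ) - 2) ≤ s

/-- The `r`-neighborhood graph of the points `x 0, …, x (n - 1)`; the nodes are the indices. -/
def neighborhoodGraph {X : Type*} [MetricSpace X] {n : ℕ} (r : ℝ) (x : Fin n → X) :
    SimpleGraph (Fin n) where
  Adj u v := u ≠ v ∧ dist (x u) (x v) ≤ r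
  symm := ⟨fun u v h => ⟨h.1.symm, by rw [dist_comm]; exact h.2⟩⟩
  loopless := ⟨fun _ h => h.1 rfl⟩

/-- The graph obtained from `G` by deleting every edge `e` whose deletion coin `del e` shows `true`
and inserting every non-edge `e` whose insertion coin `ins e` shows `true`. -/
def perturb {n : ℕ} (G : SimpleGraph (Fin n)) (del ins : Sym2 (Fin n) → Bool) :
    SimpleGraph (Fin n) where
  Adj u v := u ≠ v ∧
    ((G.Adj u v ∧ del s(u, v) = false) ∨ (¬ G.Adj u v ∧ ins s(u, v) = true))
  symm := ⟨fun u v h => ⟨h.1.symm, by rw [G.adj_comm v u, Sym2.eq_swap]; exact h.2⟩⟩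
  loopless := ⟨fun _ h => h.1 rfl⟩

/-- An outcome of the network model: the sample points, the deletion coins and the insertion coins
(one coin of each kind for every unordered pair of nodes; only the one that applies is read). -/
abbrev Outcome (X : Type*) (n : ℕ) : Type _ :=
  (Fin n → X) × (Sym2 (Fin n) → Bool) × (Sym2 (Fin n) → Bool)

/-- The law of the network model: `n` i.i.d. points with law `μ`, and, independently of them and of
each other, deletion coins showing `true` with probability `p` and insertion coins showing `true`
with probability `q`. -/
def networkLaw {X : Type*} [MeasurableSpace X] (μ : Measure X) (n : ℕ) (p q : unitInterval) :
    Measure (Outcome X n) :=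
  (Measure.pi fun _ : Fin n => μ).prod
    ((Measure.pi fun _ : Sym2 (Fin n) => ProbabilityTheory.bernoulliMeasure true false p).prod
      (Measure.pi fun _ : Sym2 (Fin n) => ProbabilityTheory.bernoulliMeasure true false q))

/-- The true graph of an outcome. -/
def trueGraph {X : Type*} [MetricSpace X] {n : ℕ} (r : ℝ) (ω : Outcome X n) :
    SimpleGraph (Fin n) :=
  neighborhoodGraph r ω.1

/-- The observed graph `G(r, p, q)` of an outcome; `p` and `q` enter through the law of `ω`. -/
def observedGraph {X : Type*} [MetricSpace X] {n : ℕ} (r : ℝ) (ω : Outcome X n) :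
    SimpleGraph (Fin n) :=
  perturb (trueGraph r ω) ω.2.1 ω.2.2

/-- The Jaccard index of the pair `u`, `v` in the graph `G`. -/
def jaccardIndex {n : ℕ} (G : SimpleGraph (Fin n)) (u v : Fin n) : ℝ :=
  ((G.neighborSet u ∩ G.neighborSet v).ncard : ℝ) /
    ((G.neighborSet u ∪ G.neighborSet v).ncard : ℝ)

/-- `τ`-Jaccard filtering: keep exactly the edges of `G` whose Jaccard index is at least `τ`. -/
def jaccardFilter {n : ℕ} (τ : ℝ) (G : SimpleGraph (Fin n)) : SimpleGraph (Fin n) where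
  Adj u v := G.Adj u v ∧ τ ≤ jaccardIndex G u v
  symm := ⟨fun u v h => ⟨h.1.symm, by
    rw [jaccardIndex, Set.inter_comm, Set.union_comm]; exact h.2⟩⟩
  loopless := ⟨fun u h => G.irrefl h.1⟩

/-- The shortest-path metric of `G'` is a `c`-approximation of that of `G`. Distances between
nodes in different components are `⊤`. -/
def IsApproximation {V : Type*} (c : ℕ) (G' G : SimpleGraph V) : Prop :=
  ∀ u v : V, G.edist u v ≤ c * G'.edist u v ∧ G'.edist u v ≤ c * G.edist u v

end JaccardFiltering

end

/-!
The probability space is exposed in two stages, the points and then the coins, and every estimate is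
a Chernoff bound of the shape `P (S ≥ (1 + t) M + y) ≤ exp (-t y)` or
`P (S ≤ (1 - t) M - y) ≤ exp (-t y)` for a sum `S` of independent indicators whose mean is
bounded by `M` (`chernoff_upper`, `chernoff_lower`). With `t ^ 2 * (s n * n) = log n` and
`y = 5 * t * (s n * n)` each failure probability is `n ^ (-5)`, whereas `t → 0` and
`y = o(s n * n)` because `s n * n = ω(log n)`.

*Points.* For two sample points at distance at most `r`, with midpoint `m`, every sample point in
`ball m (r / 2)` is a common neighbor and every neighbor of either lies in `ball m (2 * r)`.
Doubling twice therefore shows that adjacent nodes of the true graph have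
at least `3 / 4 * s * n` common
neighbors and at most `2 * L ^ 2` times as many neighbors in total
(`neighborhoodGraph_edge_tail`). All degrees are almost at least `s * n`
(`neighborhoodGraph_degree_tail`).

*Coins.* For any fixed true graph the numbers of kept neighbors and kept common neighbors are not
much below their means, and the numbers of insertions of the kinds that matter are not much above
theirs (`not_isTypicalDeletion_le`, `not_isTypicalInsertion_le`). `networkLaw_real_le` transfers
these bounds to the random true graph.

*Typical outcomes.* An edge of the true graph has about `(1 - p) ^ 2 * K` common neighbors in the
observed graph, `K` being their true number, against at most `(2 * L ^ 2 + O(c)) * K` neighbors, as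
only `O(q * n) = O(c * K)` of them are inserted; so its Jaccard index is at least `τ`
(`le_jaccardIndex_of_adj`). Two nodes `u`, `v` at distance at least `3` in the true graph, of
degrees `a` and `b`, share at most about `q * (a + b) + q ^ 2 * n` observed neighbors, all due to
insertions, out of at least about `(1 - p) * (a + b)`; so their Jaccard index is less than `τ`
(`jaccardIndex_lt_of_far`).
Hence every edge of the filtered graph joins nodes at true distance at most `2`. Conversely, the
end nodes of an edge of the true graph have a common neighbor both of whose edges to them are kept
(`exists_kept_common_neighbor`), and these two edges survive the filter. Stretching each edge of
either graph by at most `2` stretches all distances by at most `2` (`edist_le_mul_edist`).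
-/

noncomputable section

namespace JaccardFiltering

open ProbabilityTheory

/-! ### Chernoff bounds for counts of independent events -/

section Chernoff

theorem sum_indicator_eq_ncard {Ω ι : Type*} {A : ι → Set Ω} (W : Finset ι) (ω : Ω) :
    (∑ i ∈ W, (A i).indicator (1 : Ω → ℝ)) ω = ({i | i ∈ W ∧ ω ∈ A i}.ncard : ℝ) := by
  classical
  have h : {i | i ∈ W ∧ ω ∈ A i} = (W.filter fun i => ω ∈ A i : Finset ι) := by ext; simp
  rw [h, Set.ncard_coe_finset]
  simp [Finset.sum_apply, Set.indicator_apply]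

variable {Ω ι : Type*} [MeasurableSpace Ω] {P : Measure Ω} [IsProbabilityMeasure P]

/-- The bound combines `exp θ - 1 ≤ θ + θ ^ 2`, valid for `|θ| ≤ 1` of either sign, with
`1 + x ≤ exp x`. -/
theorem mgf_indicator_le {A : Set Ω} (hA : MeasurableSet A) {θ : ℝ} (hθ : |θ| ≤ 1) :
    mgf (A.indicator 1) P θ ≤ Real.exp ((θ + θ ^ 2) * P.real A) := by
  have h1 : (fun ω => Real.exp (θ * A.indicator (1 : Ω → ℝ) ω)) =
      fun ω => 1 + A.indicator (fun _ => Real.exp θ - 1) ω := by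
    ext ω
    by_cases h : ω ∈ A <;> simp [h]
  have h2 : mgf (A.indicator 1) P θ = 1 + (Real.exp θ - 1) * P.real A := by
    rw [mgf, h1, integral_add (integrable_const _)
      ((integrable_const _).indicator hA), integral_indicator_const _ hA]
    simp [mul_comm]
  have h3 : Real.exp θ - 1 ≤ θ + θ ^ 2 := by
    have := (abs_le.1 (Real.abs_exp_sub_one_sub_id_le hθ)).2
    linarith
  rw [h2]
  have h4 := Real.add_one_le_exp ((θ + θ ^ 2) * P.real A)
  have h5 := mul_le_mul_of_nonneg_right h3 (measureReal_nonneg (μ := P) (s := A))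
  linarith

theorem mgf_sum_indicator_le {A : ι → Set Ω} (hA : ∀ i, MeasurableSet (A i))
    (hI : iIndepSet A P) (W : Finset ι) {θ : ℝ} (hθ : |θ| ≤ 1) :
    mgf (∑ i ∈ W, (A i).indicator 1) P θ ≤
      Real.exp ((θ + θ ^ 2) * ∑ i ∈ W, P.real (A i)) := by
  have h := hI.iIndepFun_indicator.mgf_sum (t := θ) (fun i => measurable_one.indicator (hA i)) W
  refine h.trans_le ?_
  rw [Finset.mul_sum, Real.exp_sum]
  exact Finset.prod_le_prod (fun i _ => mgf_nonneg) fun i _ => mgf_indicator_le (hA i) hθ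

theorem integrable_exp_sum_indicator {A : ι → Set Ω} (hA : ∀ i, MeasurableSet (A i))
    (W : Finset ι) (θ : ℝ) :
    Integrable (fun ω => Real.exp (θ * (∑ i ∈ W, (A i).indicator (1 : Ω → ℝ)) ω)) P := by
  refine Integrable.of_bound (C := Real.exp (|θ| * W.card)) ?_ ?_
  · have : Measurable (∑ i ∈ W, (A i).indicator (1 : Ω → ℝ)) := by
      rw [Finset.sum_fn]
      exact Finset.measurable_sum W fun i _ => measurable_one.indicator (hA i)
    fun_prop
  · refine Filter.Eventually.of_forall fun ω => ?_
    rw [Real.norm_eq_abs, Real.abs_exp, sum_indicator_eq_ncard]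
    gcongr
    · exact le_abs_self θ
    · rw [← Set.ncard_coe_finset W]
      exact Set.ncard_le_ncard (fun i hi => hi.1) W.finite_toSet

/-- The upper tail, with relative deviation `t` and additive deviation `y`. The additive term yields
a bound that does not depend on the mean, however small the mean may be. -/
theorem chernoff_upper {A : ι → Set Ω} (hA : ∀ i, MeasurableSet (A i)) (hI : iIndepSet A P)
    (W : Finset ι) {t y M : ℝ} (ht0 : 0 ≤ t) (ht1 : t ≤ 1) (hM : ∑ i ∈ W, P.real (A i) ≤ M) :
    P.real {ω | (1 + t) * M + y ≤ ({i | i ∈ W ∧ ω ∈ A i}.ncard : ℝ)} ≤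
      Real.exp (-(t * y)) := by
  have h := measure_ge_le_exp_mul_mgf (μ := P) ((1 + t) * M + y) ht0
    (integrable_exp_sum_indicator hA W t)
  simp only [sum_indicator_eq_ncard] at h
  refine h.trans ((mul_le_mul_of_nonneg_left (mgf_sum_indicator_le hA hI W
    (by rwa [abs_of_nonneg ht0])) (Real.exp_pos _).le).trans ?_)
  rw [← Real.exp_add]
  gcongr
  nlinarith [mul_le_mul_of_nonneg_left hM (by positivity : 0 ≤ t + t ^ 2)]

theorem chernoff_lower {A : ι → Set Ω} (hA : ∀ i, MeasurableSet (A i)) (hI : iIndepSet A P)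
    (W : Finset ι) {t y M : ℝ} (ht0 : 0 ≤ t) (ht1 : t ≤ 1) (hM : M ≤ ∑ i ∈ W, P.real (A i)) :
    P.real {ω | ({i | i ∈ W ∧ ω ∈ A i}.ncard : ℝ) ≤ (1 - t) * M - y} ≤
      Real.exp (-(t * y)) := by
  have h := measure_le_le_exp_mul_mgf (μ := P) ((1 - t) * M - y) (neg_nonpos.2 ht0)
    (integrable_exp_sum_indicator hA W (-t))
  simp only [sum_indicator_eq_ncard] at h
  refine h.trans ((mul_le_mul_of_nonneg_left (mgf_sum_indicator_le hA hI W
    (by rwa [abs_neg, abs_of_nonneg ht0])) (Real.exp_pos _).le).trans ?_)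
  rw [← Real.exp_add]
  gcongr
  nlinarith [mul_le_mul_of_nonneg_left hM (by nlinarith : 0 ≤ t - t ^ 2)]

end Chernoff

/-! ### Independent coins -/

section Coins

/-- The law of independent coins indexed by `E`, each showing `true` with probability `p`. -/
abbrev coinLaw (E : Type*) [Fintype E] (p : unitInterval) : Measure (E → Bool) :=
  Measure.pi fun _ : E => bernoulliMeasure true false p

/-- The probability that a coin with parameter `p` shows `b`. -/
def coinProb (p : unitInterval) (b : Bool) : ℝ := if b then p else 1 - p

theorem bernoulliMeasure_real_singleton (p : unitInterval) (b : Bool) :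
    (bernoulliMeasure true false p).real {b} = coinProb p b := by
  rw [bernoulliMeasure_real_apply p (MeasurableSet.singleton b)]
  cases b <;> simp [coinProb]

variable {E ι : Type*} [Fintype E]

theorem coinLaw_real_forall_eq (p : unitInterval) (b : Bool) (T : Finset E) :
    (coinLaw E p).real {ω | ∀ e ∈ T, ω e = b} = coinProb p b ^ T.card := by
  classical
  have h : {ω : E → Bool | ∀ e ∈ T, ω e = b} =
      Set.univ.pi fun e => if e ∈ T then {b} else Set.univ := by
    ext ω
    simp only [Set.mem_ofPred_eq, Set.mem_univ_pi]
    refine forall_congr' fun e => ?_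
    by_cases he : e ∈ T <;> simp [he]
  rw [h, measureReal_def, Measure.pi_pi, ENNReal.toReal_prod, ← Finset.prod_const,
    ← Finset.prod_filter_mul_prod_filter_not Finset.univ (fun e => e ∈ T)]
  rw [Finset.prod_congr (g := fun _ => coinProb p b) (by ext; simp : _ = T) ?_,
    Finset.prod_eq_one (s := Finset.univ.filter fun e => e ∉ T), mul_one]
  · intro e he
    simp [(Finset.mem_filter.1 he).2]
  · intro e he
    rw [if_pos he, ← bernoulliMeasure_real_singleton, measureReal_def]

/-- Events about pairwise disjoint sets of coins are independent. -/
theorem iIndepSet_coins (p : unitInterval) (b : Bool) {T : ι → Finset E}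
    (hT : Pairwise fun i j => Disjoint (T i) (T j)) :
    iIndepSet (fun i => {ω : E → Bool | ∀ e ∈ T i, ω e = b}) (coinLaw E p) := by
  rw [iIndepSet_iff_meas_biInter fun i => MeasurableSet.of_discrete]
  classical
  intro S
  have h : (⋂ i ∈ S, {ω : E → Bool | ∀ e ∈ T i, ω e = b}) =
      {ω | ∀ e ∈ S.biUnion T, ω e = b} := by
    ext ω
    simp only [Set.mem_iInter, Set.mem_ofPred_eq, Finset.mem_biUnion]
    exact ⟨fun h e ⟨i, hi, he⟩ => h i hi e he, fun h i hi e he => h e ⟨i, hi, he⟩⟩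
  rw [h, ← ENNReal.toReal_eq_toReal_iff' (measure_ne_top _ _)
    (ENNReal.prod_ne_top fun _ _ => measure_ne_top _ _), ENNReal.toReal_prod]
  simp only [← measureReal_def, coinLaw_real_forall_eq]
  rw [Finset.card_biUnion fun i _ j _ hij => hT hij, Finset.prod_pow_eq_pow_sum]

variable {W : Set ι} {T : ι → Finset E} {k : ℕ} {t y : ℝ}

/-- Chernoff bounds for the number of `i ∈ W` such that all `k` coins in `T i` show `b`, the sets
`T i` being pairwise disjoint. -/
theorem coin_chernoff [Finite ι] (p : unitInterval) (b : Bool)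
    (hT : W.PairwiseDisjoint T) (hk : ∀ i ∈ W, (T i).card = k) (ht0 : 0 ≤ t) (ht1 : t ≤ 1) :
    (∀ M : ℝ, W.ncard * coinProb p b ^ k ≤ M → (coinLaw E p).real
      {ω | (1 + t) * M + y ≤ ({i | i ∈ W ∧ ∀ e ∈ T i, ω e = b}.ncard : ℝ)} ≤
        Real.exp (-(t * y))) ∧
    (coinLaw E p).real {ω | ({i | i ∈ W ∧ ∀ e ∈ T i, ω e = b}.ncard : ℝ) ≤
        (1 - t) * (W.ncard * coinProb p b ^ k) - y} ≤ Real.exp (-(t * y)) := by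
  classical
  -- Outside `W` the sets of coins are emptied, which makes the family disjoint everywhere.
  let T' : ι → Finset E := fun i => if i ∈ W then T i else ∅
  have hT' : Pairwise fun i j => Disjoint (T' i) (T' j) := by
    intro i j hij
    by_cases hi : i ∈ W <;> by_cases hj : j ∈ W <;> simp only [T', hi, hj, if_true, if_false,
      Finset.disjoint_empty_left, Finset.disjoint_empty_right]
    exact hT hi hj hij
  have hI := iIndepSet_coins p b hT'
  let W' : Finset ι := W.toFinite.toFinset
  have hfil (ω : E → Bool) : {i | i ∈ W' ∧ ω ∈ {ω : E → Bool | ∀ e ∈ T' i, ω e = b}} =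
      {i | i ∈ W ∧ ∀ e ∈ T i, ω e = b} := by
    ext i
    simp only [W', Set.Finite.mem_toFinset, Set.mem_ofPred_eq]
    refine and_congr_right fun hi => ?_
    simp [T', hi]
  have hsum : ∑ i ∈ W', (coinLaw E p).real {ω : E → Bool | ∀ e ∈ T' i, ω e = b} =
      W.ncard * coinProb p b ^ k := by
    rw [Finset.sum_congr rfl (g := fun _ => coinProb p b ^ k), Finset.sum_const, nsmul_eq_mul,
      Set.ncard_eq_toFinset_card W]
    intro i hi
    have hi : i ∈ W := (Set.Finite.mem_toFinset _).1 hi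
    rw [coinLaw_real_forall_eq, ← hk i hi]
    simp [T', hi]
  refine ⟨fun M hM => ?_, ?_⟩
  · have h := chernoff_upper (P := coinLaw E p) (fun i => MeasurableSet.of_discrete) hI W'
      (y := y) ht0 ht1 (hsum.trans_le hM)
    simpa only [hfil] using h
  · have h := chernoff_lower (P := coinLaw E p) (fun i => MeasurableSet.of_discrete) hI W'
      (y := y) ht0 ht1 hsum.ge
    simpa only [hfil] using h

end Coins

/-! ### Independent sample points -/

section Points

variable {X ι : Type*} [MeasurableSpace X] (μ : Measure X) [IsProbabilityMeasure μ]

theorem iIndepSet_points [Fintype ι] {B : Set X} (hB : MeasurableSet B) :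
    iIndepSet (fun i => {y : ι → X | y i ∈ B}) (Measure.pi fun _ : ι => μ) := by
  have hI : iIndepFun (fun (i : ι) (y : ι → X) => y i) (Measure.pi fun _ : ι => μ) :=
    iIndepFun_pi (X := fun _ => id) fun _ => aemeasurable_id
  refine (iIndepSet_iff_meas_biInter fun i => measurable_pi_apply i hB).2 ?_
  intro S
  exact hI.measure_inter_preimage_eq_mul S fun i _ => hB

theorem pi_real_point_mem [Fintype ι] {B : Set X} (hB : MeasurableSet B) (i : ι) :
    (Measure.pi fun _ : ι => μ).real {y : ι → X | y i ∈ B} = μ.real B :=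
  (measurePreserving_eval (fun _ : ι => μ) i).measureReal_preimage hB.nullMeasurableSet

/-- To bound the probability of an event it suffices to bound it conditionally on the values of
the coordinates outside `s`. -/
theorem pi_real_le_of_forall_updateFinset_le [Fintype ι] [DecidableEq ι]
    (s : Finset ι) {S : Set (ι → X)} (hS : MeasurableSet S) {δ : ℝ}
    (h : ∀ x : ι → X,
      (Measure.pi fun _ : s => μ).real {y | Function.updateFinset x s y ∈ S} ≤ δ) :
    (Measure.pi fun _ : ι => μ).real S ≤ δ := by
  have h1 := lintegral_le_of_lmarginal_le (μ := fun _ : ι => μ) s (f := S.indicator 1)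
    (g := fun _ => ENNReal.ofReal δ) (measurable_one.indicator hS) measurable_const ?_
  · rw [lintegral_indicator_one hS] at h1
    obtain ⟨x⟩ := (Measure.pi fun _ : ι => μ).nonempty_of_neZero
    refine ENNReal.toReal_le_of_le_ofReal (measureReal_nonneg.trans (h x)) ?_
    simpa using h1
  · intro x
    have hm : MeasurableSet {y : s → X | Function.updateFinset x s y ∈ S} :=
      measurable_updateFinset hS
    have : (fun y : s → X => S.indicator (1 : (ι → X) → ENNReal) (Function.updateFinset x s y)) =
        {y : s → X | Function.updateFinset x s y ∈ S}.indicator 1 := rfl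
    simp only [lmarginal, this]
    rw [lintegral_indicator_one hm]
    simpa using (ENNReal.le_ofReal_iff_toReal_le (measure_ne_top _ _)
      (measureReal_nonneg.trans (h x))).2 (h x)

/-- Chernoff bounds for the number of points of a random sample that fall into `B`, the
coordinates outside `s` being held fixed. -/
theorem point_chernoff [DecidableEq ι] (s : Finset ι) (x : ι → X) {B : Set X} (hB : MeasurableSet B)
    {t y M : ℝ} (ht0 : 0 ≤ t) (ht1 : t ≤ 1) :
    (s.card * μ.real B ≤ M → (Measure.pi fun _ : s => μ).real
      {z | (1 + t) * M + y ≤ ({w | w ∈ s ∧ Function.updateFinset x s z w ∈ B}.ncard : ℝ)} ≤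
        Real.exp (-(t * y))) ∧
    (M ≤ s.card * μ.real B → (Measure.pi fun _ : s => μ).real
      {z | ({w | w ∈ s ∧ Function.updateFinset x s z w ∈ B}.ncard : ℝ) ≤ (1 - t) * M - y} ≤
        Real.exp (-(t * y))) := by
  have hcount (z : s → X) : {w | w ∈ s ∧ Function.updateFinset x s z w ∈ B}.ncard =
      {i | i ∈ (Finset.univ : Finset s) ∧ z ∈ {z : s → X | z i ∈ B}}.ncard := by
    rw [← Set.ncard_image_of_injective _ Subtype.val_injective]
    congr 1
    ext w
    simp only [Set.mem_ofPred_eq, Finset.mem_univ, true_and, Set.mem_image, Subtype.exists,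
      exists_and_right, exists_eq_right, Function.updateFinset]
    constructor
    · rintro ⟨hw, h⟩
      exact ⟨hw, by simpa [hw] using h⟩
    · rintro ⟨hw, h⟩
      exact ⟨hw, by simpa [hw] using h⟩
  have hsum : ∑ i : s, (Measure.pi fun _ : s => μ).real {z : s → X | z i ∈ B} =
      s.card * μ.real B := by
    simp [pi_real_point_mem μ hB]
  simp only [hcount]
  exact ⟨fun hM => chernoff_upper (fun i => measurable_pi_apply i hB) (iIndepSet_points μ hB) _
      ht0 ht1 (hsum.trans_le hM),
    fun hM => chernoff_lower (fun i => measurable_pi_apply i hB) (iIndepSet_points μ hB) _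
      ht0 ht1 (hM.trans hsum.ge)⟩

end Points

/-! ### Union bounds -/

section UnionBound

variable {Ω : Type*} [MeasurableSpace Ω] {P : Measure Ω}

theorem measureReal_not_forall_le {κ : Type*} [Fintype κ] {Q : κ → Ω → Prop} {δ : ℝ}
    (h : ∀ i, P.real {ω | ¬ Q i ω} ≤ δ) :
    P.real {ω | ¬ ∀ i, Q i ω} ≤ Fintype.card κ * δ := by
  have h1 : {ω | ¬ ∀ i, Q i ω} = ⋃ i, {ω | ¬ Q i ω} := by ext; simp
  rw [h1]
  refine (measureReal_iUnion_fintype_le _).trans ?_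
  refine (Finset.sum_le_sum fun i _ => h i).trans ?_
  simp

theorem measureReal_not_and_le {Q R : Ω → Prop} {a b : ℝ}
    (hQ : P.real {ω | ¬ Q ω} ≤ a) (hR : P.real {ω | ¬ R ω} ≤ b) :
    P.real {ω | ¬ (Q ω ∧ R ω)} ≤ a + b := by
  have h1 : {ω | ¬ (Q ω ∧ R ω)} = {ω | ¬ Q ω} ∪ {ω | ¬ R ω} := by
    ext ω
    simp only [Set.mem_ofPred_eq, Set.mem_union]
    tauto
  rw [h1]
  exact (measureReal_union_le _ _).trans (add_le_add hQ hR)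

theorem one_sub_le_measureReal [IsProbabilityMeasure P] {Q R : Ω → Prop} {δ : ℝ}
    (hQR : ∀ ω, Q ω → R ω) (hQ : P.real {ω | ¬ Q ω} ≤ δ) : 1 - δ ≤ P.real {ω | R ω} := by
  have hcover : (Set.univ : Set Ω) ⊆ {ω | R ω} ∪ {ω | ¬ Q ω} := fun ω _ =>
    or_iff_not_imp_right.2 fun h => hQR ω (not_not.1 h)
  have h := (measureReal_mono (μ := P) hcover).trans (measureReal_union_le _ _)
  rw [probReal_univ] at h
  linarith

end UnionBound

/-! ### Midpoints and doubling -/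

section Geometry

variable {X : Type*} [MetricSpace X]

theorem IsGeodesicSpace.exists_midpoint (hX : IsGeodesicSpace X) (a b : X) :
    ∃ m, dist a m = dist a b / 2 ∧ dist b m = dist a b / 2 := by
  obtain ⟨γ, h0, h1, h⟩ := hX a b
  have hd : 0 ≤ dist a b := dist_nonneg
  have hmid : dist a b / 2 ∈ Set.Icc 0 (dist a b) := ⟨by linarith, by linarith⟩
  have e1 := h 0 ⟨le_rfl, hd⟩ _ hmid
  have e2 := h _ ⟨hd, le_rfl⟩ _ hmid
  rw [h0, zero_sub, abs_neg, abs_of_nonneg hmid.1] at e1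
  rw [h1, abs_of_nonneg (by linarith), sub_half] at e2
  exact ⟨_, e1, e2⟩

theorem IsDoublingMeasure.one_le [MeasurableSpace X] [Nonempty X] {μ : Measure X}
    [IsFiniteMeasure μ] {L : ℝ} (hμ : IsDoublingMeasure μ L) : 1 ≤ L := by
  obtain ⟨x⟩ := ‹Nonempty X›
  have hpos : 0 < μ.real (Metric.ball x 1) :=
    ENNReal.toReal_pos (hμ.ball_pos x 1 one_pos).ne' (measure_ne_top _ _)
  have h1 : μ.real (Metric.ball x 1) ≤ μ.real (Metric.ball x (2 * 1)) :=
    measureReal_mono (Metric.ball_subset_ball (by norm_num))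
  have h2 := hμ.doubling x 1 one_pos
  nlinarith

theorem IsDoublingMeasure.ball_four_mul_le [MeasurableSpace X] {μ : Measure X}
    {L : ℝ} (hL : 0 ≤ L) (hμ : IsDoublingMeasure μ L) (x : X) {ρ : ℝ} (hρ : 0 < ρ) :
    μ.real (Metric.ball x (4 * ρ)) ≤ L ^ 2 * μ.real (Metric.ball x ρ) := by
  have h1 := hμ.doubling x (2 * ρ) (by positivity)
  have h2 := mul_le_mul_of_nonneg_left (hμ.doubling x ρ hρ) hL
  rw [show 4 * ρ = 2 * (2 * ρ) by ring]
  linarith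

end Geometry

/-! ### The random neighborhood graph -/

section NeighborhoodGraph

variable {X : Type*} [MetricSpace X] [CompactSpace X] [MeasurableSpace X] [BorelSpace X] {n : ℕ}

theorem measurableSet_neighborhoodGraph_mem (r : ℝ) (Γ : Set (SimpleGraph (Fin n))) :
    MeasurableSet {x : Fin n → X | neighborhoodGraph r x ∈ Γ} := by
  have : SecondCountableTopology X := UniformSpace.secondCountable_of_separable X
  have h : {x : Fin n → X | neighborhoodGraph r x ∈ Γ} =
      ⋃ H ∈ Γ, ⋂ u, ⋂ v, {x | (neighborhoodGraph r x).Adj u v ↔ H.Adj u v} := by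
    ext x
    simp only [Set.mem_ofPred_eq, Set.mem_iUnion, Set.mem_iInter, exists_prop]
    constructor
    · exact fun hx => ⟨_, hx, fun u v => Iff.rfl⟩
    · rintro ⟨H, hH, hx⟩
      have : neighborhoodGraph r x = H := by ext u v; exact hx u v
      rwa [this]
  rw [h]
  refine MeasurableSet.biUnion (Set.to_countable Γ) fun H _ => MeasurableSet.iInter fun u =>
    MeasurableSet.iInter fun v => ?_
  have hd : MeasurableSet {x : Fin n → X | dist (x u) (x v) ≤ r} :=
    measurableSet_le (by fun_prop) measurable_const
  exact MeasurableSet.iff ((MeasurableSet.const _).inter hd) (MeasurableSet.const _)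

variable (μ : Measure X) [IsProbabilityMeasure μ] {L r s t y : ℝ}

theorem neighborhoodGraph_degree_tail (hr : 0 < r)
    (hs : ∀ x : X, s ≤ μ.real (Metric.ball x (r / 2))) (ht0 : 0 ≤ t) (ht1 : t ≤ 1) (u : Fin n) :
    (Measure.pi fun _ : Fin n => μ).real {x | ¬ (1 - t) * ((n - 1) * s) - y <
      ((neighborhoodGraph r x).neighborSet u).ncard} ≤ Real.exp (-(t * y)) := by
  refine pi_real_le_of_forall_updateFinset_le μ {u}ᶜ (measurableSet_neighborhoodGraph_mem r
    {G | ¬ (1 - t) * ((n - 1) * s) - y < (G.neighborSet u).ncard}) fun x => ?_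
  have hn : (({u}ᶜ : Finset (Fin n)).card : ℝ) = n - 1 := by
    rw [Finset.card_compl, Finset.card_singleton, Fintype.card_fin, Nat.cast_sub (Fin.pos u)]
    simp
  have hn0 : (0 : ℝ) ≤ n - 1 := hn ▸ Nat.cast_nonneg _
  refine (measureReal_mono ?_ (measure_ne_top _ _)).trans
    ((point_chernoff μ {u}ᶜ x (Metric.isOpen_ball (x := x u) (ε := r / 2)).measurableSet
      (y := y) (M := (n - 1) * s) ht0 ht1).2 (by
        rw [hn]; exact mul_le_mul_of_nonneg_left (hs _) hn0))
  intro z hz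
  simp only [Set.mem_ofPred_eq, not_lt] at hz ⊢
  refine le_trans ?_ hz
  gcongr
  · exact Set.toFinite _
  · rintro w ⟨hw, hwB⟩
    have hu : Function.updateFinset x {u}ᶜ z u = x u := by simp [Function.updateFinset]
    refine ⟨fun h => by simp [h] at hw, ?_⟩
    rw [hu, dist_comm]
    exact (Metric.mem_ball.1 hwB).le.trans (by linarith)

/-- Conditionally on the two points `x u` and `x v`, the other points in the balls of radii `r / 2`
and `2 * r` around their midpoint are counted. -/
theorem neighborhoodGraph_edge_tail (hX : IsGeodesicSpace X) (hμ : IsDoublingMeasure μ L)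
    (hr : 0 < r) (hs0 : 0 < s) (hs : ∀ x : X, s ≤ μ.real (Metric.ball x (r / 2)))
    (hn : (1000 : ℝ) ≤ n) (hsn : 1000 ≤ s * n) (ht0 : 0 ≤ t) (ht1 : t ≤ 1 / 100)
    (hy : y = 5 * t * (s * n)) (u v : Fin n) :
    (Measure.pi fun _ : Fin n => μ).real {x | ¬ ((neighborhoodGraph r x).Adj u v →
      3 / 4 * (s * n) ≤ (((neighborhoodGraph r x).neighborSet u ∩
        (neighborhoodGraph r x).neighborSet v).ncard : ℝ) ∧
      (((neighborhoodGraph r x).neighborSet u ∪ (neighborhoodGraph r x).neighborSet v).ncard : ℝ) ≤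
        2 * L ^ 2 * ((neighborhoodGraph r x).neighborSet u ∩
          (neighborhoodGraph r x).neighborSet v).ncard)} ≤ 2 * Real.exp (-(t * y)) := by
  -- The pair `{u, v}` has two elements only if `u ≠ v`; otherwise there is no edge.
  by_cases huv : u = v
  · simp [huv, Real.exp_nonneg]
  refine pi_real_le_of_forall_updateFinset_le μ {u, v}ᶜ (measurableSet_neighborhoodGraph_mem r
    {G | ¬ (G.Adj u v → 3 / 4 * (s * n) ≤ ((G.neighborSet u ∩ G.neighborSet v).ncard : ℝ) ∧
      ((G.neighborSet u ∪ G.neighborSet v).ncard : ℝ) ≤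
        2 * L ^ 2 * (G.neighborSet u ∩ G.neighborSet v).ncard)}) fun x => ?_
  have hcard : ((({u, v} : Finset (Fin n))ᶜ).card : ℝ) = n - 2 := by
    have h2 := Finset.card_pair huv
    have h3 := Finset.card_add_card_compl ({u, v} : Finset (Fin n))
    rw [h2, Fintype.card_fin] at h3
    have h4 : (2 : ℝ) + ((({u, v} : Finset (Fin n))ᶜ).card : ℝ) = n := by exact_mod_cast h3
    linarith
  have hu (z) : Function.updateFinset x ({u, v} : Finset (Fin n))ᶜ z u = x u := by
    simp [Function.updateFinset]
  have hv (z) : Function.updateFinset x ({u, v} : Finset (Fin n))ᶜ z v = x v := by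
    simp [Function.updateFinset]
  by_cases hd : dist (x u) (x v) ≤ r
  swap
  · refine (measureReal_mono (s₂ := ∅) ?_).trans (by simp [Real.exp_nonneg])
    intro z hz
    refine (hz fun hadj => ?_).elim
    have := hadj.2
    rw [hu, hv] at this
    exact absurd this hd
  obtain ⟨m, hm1, hm2⟩ := hX.exists_midpoint (x u) (x v)
  have : Nonempty X := ⟨m⟩
  have hL : 1 ≤ L := hμ.one_le
  have hβ := hs m
  have hβ2 := hμ.ball_four_mul_le (by linarith) m (ρ := r / 2) (by linarith)
  set β := μ.real (Metric.ball m (r / 2))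
  have hn2 : (0 : ℝ) ≤ n - 2 := by linarith
  have h1 := (point_chernoff μ ({u, v} : Finset (Fin n))ᶜ x
    (Metric.isOpen_ball (x := m) (ε := r / 2)).measurableSet (t := t) (y := y)
    (M := (n - 2) * β) ht0 (by linarith)).2 (by rw [hcard])
  have h2 := (point_chernoff μ ({u, v} : Finset (Fin n))ᶜ x
    (Metric.isOpen_ball (x := m) (ε := 4 * (r / 2))).measurableSet (t := t) (y := y)
    (M := (n - 2) * (L ^ 2 * β)) ht0 (by linarith)).1
      (by rw [hcard]; exact mul_le_mul_of_nonneg_left hβ2 hn2)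
  refine (measureReal_mono ?_ (measure_ne_top _ _)).trans
    ((measureReal_union_le _ _).trans ((add_le_add h1 h2).trans_eq (two_mul _).symm))
  intro z hz
  by_contra hcon
  simp only [Set.mem_union, Set.mem_ofPred_eq, not_or, not_le] at hcon
  obtain ⟨hN1, hN2⟩ := hcon
  refine hz fun hadj => ?_
  set x' := Function.updateFinset x ({u, v} : Finset (Fin n))ᶜ z
  replace hu : x' u = x u := hu z
  replace hv : x' v = x v := hv z
  set N1 := {w | w ∈ ({u, v} : Finset (Fin n))ᶜ ∧ x' w ∈ Metric.ball m (r / 2)}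
  set N2 := {w | w ∈ ({u, v} : Finset (Fin n))ᶜ ∧ x' w ∈ Metric.ball m (4 * (r / 2))}
  have hK : (N1.ncard : ℝ) ≤ (((neighborhoodGraph r x').neighborSet u ∩
      (neighborhoodGraph r x').neighborSet v).ncard : ℝ) := by
    gcongr
    · exact Set.toFinite _
    rintro w ⟨hw, hwB⟩
    simp only [Finset.mem_compl, Finset.mem_insert, Finset.mem_singleton, not_or] at hw
    rw [Metric.mem_ball] at hwB
    refine ⟨⟨Ne.symm hw.1, ?_⟩, ⟨Ne.symm hw.2, ?_⟩⟩
    · rw [hu]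
      linarith [dist_triangle_right (x u) (x' w) m]
    · rw [hv]
      linarith [dist_triangle_right (x v) (x' w) m]
  have hU : (((neighborhoodGraph r x').neighborSet u ∪
      (neighborhoodGraph r x').neighborSet v).ncard : ℝ) ≤ 2 + N2.ncard := by
    have hsub : (neighborhoodGraph r x').neighborSet u ∪ (neighborhoodGraph r x').neighborSet v ⊆
        {u, v} ∪ N2 := by
      intro w hw
      by_cases hwuv : w = u ∨ w = v
      · exact Or.inl hwuv
      refine Or.inr ⟨by simpa using hwuv, ?_⟩
      rw [Metric.mem_ball]
      rcases hw with hw | hw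
      · have := hw.2
        rw [hu] at this
        linarith [dist_triangle_left (x' w) m (x u)]
      · have := hw.2
        rw [hv] at this
        linarith [dist_triangle_left (x' w) m (x v)]
    have h3 := (Set.ncard_le_ncard hsub (Set.toFinite _)).trans (Set.ncard_union_le _ _)
    rw [Set.ncard_pair huv] at h3
    exact_mod_cast h3
  generalize (((neighborhoodGraph r x').neighborSet u ∩
      (neighborhoodGraph r x').neighborSet v).ncard : ℝ) = K at *
  generalize (((neighborhoodGraph r x').neighborSet u ∪
      (neighborhoodGraph r x').neighborSet v).ncard : ℝ) = U at *
  generalize (N1.ncard : ℝ) = k1 at *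
  generalize (N2.ncard : ℝ) = k2 at *
  -- With `t ≤ 1 / 100`, all deviations together change the two means `n * β` and `n * L ^ 2 * β` by
  -- less than a tenth, whence the final constants `3 / 4` and `2`.
  have hβ0 : 0 < β := hs0.trans_le hβ
  have hsβ : s * n ≤ β * n := mul_le_mul_of_nonneg_right hβ (by linarith)
  have hL2 : 1 ≤ L ^ 2 := one_le_pow₀ hL
  have hβn : 0 < β * n := by linarith
  have hyβ : y ≤ 5 / 100 * (β * n) := by
    rw [hy]
    nlinarith
  have hK' : 9 / 10 * (β * n) ≤ K := by
    have e1 : (998 / 1000 : ℝ) * n ≤ n - 2 := by linarith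
    have e2 : 998 / 1000 * (β * n) ≤ (n - 2) * β := by nlinarith
    have e3 : 99 / 100 * ((n - 2) * β) ≤ (1 - t) * ((n - 2) * β) :=
      mul_le_mul_of_nonneg_right (by linarith) (by positivity)
    linarith
  have hU' : U ≤ 107 / 100 * (L ^ 2 * (β * n)) := by
    have e1 : (n - 2) * (L ^ 2 * β) ≤ L ^ 2 * (β * n) := by
      nlinarith [mul_pos (by linarith : 0 < L ^ 2) hβ0]
    have e2 : (1 + t) * ((n - 2) * (L ^ 2 * β)) ≤ 101 / 100 * (L ^ 2 * (β * n)) :=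
      mul_le_mul (by linarith) e1 (by positivity) (by norm_num)
    have e3 : β * n ≤ L ^ 2 * (β * n) := le_mul_of_one_le_left hβn.le hL2
    linarith
  refine ⟨by linarith, ?_⟩
  have e4 := mul_le_mul_of_nonneg_left hK' (by linarith : 0 ≤ L ^ 2)
  nlinarith [mul_pos (by linarith : 0 < L ^ 2) hβn]

end NeighborhoodGraph

/-! ### Typical graphs and coins -/

section Typical

variable {n : ℕ}

/-- The sample graph `G` is typical: no degree is much smaller than its least possible mean, and
adjacent nodes have many common neighbors, a fixed proportion of all their neighbors. Statements
about two nodes quantify over one pair, so that a single union bound covers them. -/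
structure IsTypicalGraph (G : SimpleGraph (Fin n)) (L s t y : ℝ) : Prop where
  degree : ∀ u, (1 - t) * ((n - 1) * s) - y < (G.neighborSet u).ncard
  edge : ∀ e : Fin n × Fin n, G.Adj e.1 e.2 →
    3 / 4 * (s * n) ≤ ((G.neighborSet e.1 ∩ G.neighborSet e.2).ncard : ℝ) ∧
    ((G.neighborSet e.1 ∪ G.neighborSet e.2).ncard : ℝ) ≤
      2 * L ^ 2 * (G.neighborSet e.1 ∩ G.neighborSet e.2).ncard

/-- The deletion coins are typical for `G`: the numbers of neighbors, and of common neighbors, whose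
edges are all kept are not much smaller than their means. -/
structure IsTypicalDeletion (G : SimpleGraph (Fin n)) (p t y : ℝ) (del : Sym2 (Fin n) → Bool) :
    Prop where
  neighbors : ∀ u, (1 - t) * ((G.neighborSet u).ncard * (1 - p)) - y <
    {w | w ∈ G.neighborSet u ∧ del s(u, w) = false}.ncard
  common : ∀ e : Fin n × Fin n, e.1 ≠ e.2 →
    (1 - t) * ((G.neighborSet e.1 ∩ G.neighborSet e.2).ncard * (1 - p) ^ 2) - y <
      {w | w ∈ G.neighborSet e.1 ∩ G.neighborSet e.2 ∧
        del s(e.1, w) = false ∧ del s(e.2, w) = false}.ncard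

/-- The insertion coins are typical for `G`: the numbers of nodes that insertion could join to a
given node, of neighbors of one node that it could join to another one, and of nodes that it could
join to both of two given nodes, are not much larger than their means. The first number may count
the unused coin at `s(u, u)`, which does no harm to an upper bound. -/
structure IsTypicalInsertion (G : SimpleGraph (Fin n)) (q t y : ℝ) (ins : Sym2 (Fin n) → Bool) :
    Prop where
  nodes : ∀ u, ({w | ins s(u, w) = true}.ncard : ℝ) < (1 + t) * (n * q) + y
  neighbors : ∀ e : Fin n × Fin n,
    ({w | w ∈ G.neighborSet e.1 ∧ ins s(e.2, w) = true}.ncard : ℝ) <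
      (1 + t) * ((G.neighborSet e.1).ncard * q) + y
  common : ∀ e : Fin n × Fin n, e.1 ≠ e.2 →
    ({w | (w ≠ e.1 ∧ w ≠ e.2) ∧ ins s(e.1, w) = true ∧ ins s(e.2, w) = true}.ncard : ℝ) <
      (1 + t) * (n * q ^ 2) + y

theorem pairwiseDisjoint_singleton_pair (u : Fin n) (W : Set (Fin n)) :
    W.PairwiseDisjoint fun w => ({s(u, w)} : Finset (Sym2 (Fin n))) := by
  intro w _ w' _ hww'
  simp only [Function.onFun, Finset.disjoint_singleton, ne_eq, Sym2.eq_iff]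
  grind

theorem pairwiseDisjoint_two_pairs {u v : Fin n} {W : Set (Fin n)} (hu : u ∉ W) (hv : v ∉ W) :
    W.PairwiseDisjoint fun w => ({s(u, w), s(v, w)} : Finset (Sym2 (Fin n))) := by
  intro w hw w' hw' hww'
  have h1 : w ≠ u := fun h => hu (h ▸ hw)
  have h2 : w ≠ v := fun h => hv (h ▸ hw)
  have h3 : w' ≠ u := fun h => hu (h ▸ hw')
  have h4 : w' ≠ v := fun h => hv (h ▸ hw')
  rw [Function.onFun, Finset.disjoint_left]
  intro e he he'
  simp only [Finset.mem_insert, Finset.mem_singleton] at he he'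
  rcases he with rfl | rfl <;> rcases he' with h | h <;>
    rw [Sym2.eq_iff] at h <;> tauto

theorem card_two_pairs {u v : Fin n} (huv : u ≠ v) (w : Fin n) :
    ({s(u, w), s(v, w)} : Finset (Sym2 (Fin n))).card = 2 := by
  refine Finset.card_pair fun h => ?_
  rw [Sym2.eq_iff] at h
  grind

variable (G : SimpleGraph (Fin n)) (p : unitInterval) {t y : ℝ}

theorem not_isTypicalDeletion_le (ht0 : 0 ≤ t) (ht1 : t ≤ 1) :
    (coinLaw (Sym2 (Fin n)) p).real {del | ¬ IsTypicalDeletion G p t y del} ≤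
      n * Real.exp (-(t * y)) + (n * n) * Real.exp (-(t * y)) := by
  have h1 (u : Fin n) := (coin_chernoff (y := y) p false
    (pairwiseDisjoint_singleton_pair u (G.neighborSet u)) (fun w _ => Finset.card_singleton _)
    ht0 ht1).2
  have h2 (e : Fin n × Fin n) : (coinLaw (Sym2 (Fin n)) p).real {del | ¬ (e.1 ≠ e.2 →
      (1 - t) * ((G.neighborSet e.1 ∩ G.neighborSet e.2).ncard * (1 - p) ^ 2) - y <
      ({w | w ∈ G.neighborSet e.1 ∩ G.neighborSet e.2 ∧
        del s(e.1, w) = false ∧ del s(e.2, w) = false}.ncard : ℝ))} ≤ Real.exp (-(t * y)) := by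
    by_cases he : e.1 = e.2
    · simp [he, Real.exp_nonneg]
    have h := (coin_chernoff (y := y) p false
      (pairwiseDisjoint_two_pairs (u := e.1) (v := e.2) (W := G.neighborSet e.1 ∩ G.neighborSet e.2)
        (fun h => G.irrefl h.1) (fun h => G.irrefl h.2))
      (fun w _ => card_two_pairs he w) ht0 ht1).2
    simpa [coinProb, he, -Set.mem_inter_iff] using h
  have h3 := measureReal_not_and_le
    (measureReal_not_forall_le (P := coinLaw (Sym2 (Fin n)) p) (Q := fun u del =>
      (1 - t) * ((G.neighborSet u).ncard * (1 - p)) - y <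
        ({w | w ∈ G.neighborSet u ∧ del s(u, w) = false}.ncard : ℝ)) fun u => by
      simpa [coinProb] using h1 u)
    (measureReal_not_forall_le h2)
  simp only [Fintype.card_prod, Fintype.card_fin, Nat.cast_mul] at h3
  refine (measureReal_mono ?_ (measure_ne_top _ _)).trans h3
  exact fun del hdel h => hdel ⟨h.1, h.2⟩

theorem not_isTypicalInsertion_le (ht0 : 0 ≤ t) (ht1 : t ≤ 1) :
    (coinLaw (Sym2 (Fin n)) p).real {ins | ¬ IsTypicalInsertion G p t y ins} ≤
      n * Real.exp (-(t * y)) +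
        ((n * n) * Real.exp (-(t * y)) + (n * n) * Real.exp (-(t * y))) := by
  have h1 (u : Fin n) := (coin_chernoff (y := y) p true
    (pairwiseDisjoint_singleton_pair u Set.univ) (fun w _ => Finset.card_singleton _)
    ht0 ht1).1 (n * p) (by simp [coinProb, Set.ncard_univ])
  have h2 (e : Fin n × Fin n) := (coin_chernoff (y := y) p true
    (pairwiseDisjoint_singleton_pair e.2 (G.neighborSet e.1)) (fun w _ => Finset.card_singleton _)
    ht0 ht1).1 ((G.neighborSet e.1).ncard * p) (by simp [coinProb])
  have h3 (e : Fin n × Fin n) : (coinLaw (Sym2 (Fin n)) p).real {ins | ¬ (e.1 ≠ e.2 →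
      ({w | (w ≠ e.1 ∧ w ≠ e.2) ∧ ins s(e.1, w) = true ∧ ins s(e.2, w) = true}.ncard : ℝ) <
      (1 + t) * (n * (p : ℝ) ^ 2) + y)} ≤ Real.exp (-(t * y)) := by
    by_cases he : e.1 = e.2
    · simp [he, Real.exp_nonneg]
    have h := (coin_chernoff (y := y) p true
      (pairwiseDisjoint_two_pairs (u := e.1) (v := e.2) (W := {w | w ≠ e.1 ∧ w ≠ e.2})
        (fun h => h.1 rfl) (fun h => h.2 rfl))
      (fun w _ => card_two_pairs he w) ht0 ht1).1 (n * (p : ℝ) ^ 2) (by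
        simp only [coinProb, if_true]
        gcongr
        exact (Set.ncard_le_ncard (Set.subset_univ _)).trans_eq (by simp [Set.ncard_univ]))
    simpa [coinProb, he] using h
  have h4 := measureReal_not_and_le
    (measureReal_not_forall_le (P := coinLaw (Sym2 (Fin n)) p) (Q := fun u ins =>
      ({w | ins s(u, w) = true}.ncard : ℝ) < (1 + t) * (n * p) + y) fun u => by
      simpa using h1 u)
    (measureReal_not_and_le
    (measureReal_not_forall_le (P := coinLaw (Sym2 (Fin n)) p) (Q := fun e : Fin n × Fin n =>
      fun ins => ({w | w ∈ G.neighborSet e.1 ∧ ins s(e.2, w) = true}.ncard : ℝ) <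
      (1 + t) * ((G.neighborSet e.1).ncard * p) + y) fun e => by
      simpa using h2 e)
    (measureReal_not_forall_le h3))
  simp only [Fintype.card_prod, Fintype.card_fin, Nat.cast_mul] at h4
  refine (measureReal_mono ?_ (measure_ne_top _ _)).trans h4
  exact fun del hdel h => hdel ⟨h.1, h.2.1, h.2.2⟩

end Typical

/-! ### The network model is typical with high probability -/

section Network

theorem networkLaw_real_points {X : Type*} [MeasurableSpace X] (μ : Measure X)
    {n : ℕ} {p q : unitInterval} (S : Set (Fin n → X)) :
    (networkLaw μ n p q).real {ω | ω.1 ∈ S} = (Measure.pi fun _ : Fin n => μ).real S := by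
  have h : {ω : Outcome X n | ω.1 ∈ S} = S ×ˢ Set.univ := by ext; simp
  rw [h, networkLaw, measureReal_prod_prod, probReal_univ, mul_one]

variable {X : Type*} [MetricSpace X] [CompactSpace X] [MeasurableSpace X] [BorelSpace X] {n : ℕ}
  (μ : Measure X) [IsProbabilityMeasure μ] {p q : unitInterval} {L r s t y : ℝ}

instance : IsProbabilityMeasure (networkLaw μ n p q) := by
  unfold networkLaw
  infer_instance

/-- A bound on the probability of an event that holds for the coins alone, whatever the true graph
may be, holds for the network model. -/
theorem networkLaw_real_le {Q : SimpleGraph (Fin n) →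
      (Sym2 (Fin n) → Bool) × (Sym2 (Fin n) → Bool) → Prop} {δ : ℝ}
    (hQ : ∀ G, ((coinLaw (Sym2 (Fin n)) p).prod (coinLaw (Sym2 (Fin n)) q)).real {c | Q G c} ≤ δ) :
    (networkLaw μ n p q).real {ω | Q (trueGraph r ω) ω.2} ≤ δ := by
  have hδ : 0 ≤ δ := measureReal_nonneg.trans (hQ ⊥)
  have hS : MeasurableSet {ω : Outcome X n | Q (trueGraph r ω) ω.2} := by
    have h : {ω : Outcome X n | Q (trueGraph r ω) ω.2} =
        ⋃ G, {x | neighborhoodGraph r x ∈ ({G} : Set _)} ×ˢ {c | Q G c} := by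
      ext ω
      simp [trueGraph]
    rw [h]
    exact MeasurableSet.iUnion fun G =>
      (measurableSet_neighborhoodGraph_mem r {G}).prod MeasurableSet.of_discrete
  refine ENNReal.toReal_le_of_le_ofReal hδ ?_
  rw [networkLaw, Measure.prod_apply hS]
  refine (lintegral_mono (g := fun _ => ENNReal.ofReal δ) fun x => ?_).trans (by simp)
  exact (ENNReal.le_ofReal_iff_toReal_le (measure_ne_top _ _) hδ).2 (hQ (neighborhoodGraph r x))

theorem networkLaw_not_typical_le (hX : IsGeodesicSpace X) (hμ : IsDoublingMeasure μ L)
    (hr : 0 < r) (hs0 : 0 < s) (hs : ∀ x : X, s ≤ μ.real (Metric.ball x (r / 2)))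
    (hn : (1000 : ℝ) ≤ n) (hsn : 1000 ≤ s * n) (ht0 : 0 ≤ t) (ht1 : t ≤ 1 / 100)
    (hy : y = 5 * t * (s * n)) :
    (networkLaw μ n p q).real {ω | ¬ (IsTypicalGraph (trueGraph r ω) L s t y ∧
      IsTypicalDeletion (trueGraph r ω) p t y ω.2.1 ∧
      IsTypicalInsertion (trueGraph r ω) q t y ω.2.2)} ≤ 6 * n ^ 2 * Real.exp (-(t * y)) := by
  have h1 : (networkLaw μ n p q).real {ω | ¬ IsTypicalGraph (trueGraph r ω) L s t y} ≤
      n * Real.exp (-(t * y)) + (n * n) * (2 * Real.exp (-(t * y))) := by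
    refine (networkLaw_real_points μ
      {x | ¬ IsTypicalGraph (neighborhoodGraph r x) L s t y}).trans_le ?_
    have h := measureReal_not_and_le
      (measureReal_not_forall_le (neighborhoodGraph_degree_tail (n := n) (y := y) μ hr hs ht0
        (by linarith)))
      (measureReal_not_forall_le fun e : Fin n × Fin n =>
        neighborhoodGraph_edge_tail μ hX hμ hr hs0 hs hn hsn ht0 ht1 hy e.1 e.2)
    simp only [Fintype.card_prod, Fintype.card_fin, Nat.cast_mul] at h
    refine (measureReal_mono ?_ (measure_ne_top _ _)).trans h
    exact fun x hx h => hx ⟨h.1, h.2⟩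
  have h2 := networkLaw_real_le (r := r) (p := p) (q := q) μ
    (Q := fun G c => ¬ IsTypicalDeletion G p t y c.1) fun G => by
    have h : {c : (Sym2 (Fin n) → Bool) × (Sym2 (Fin n) → Bool) |
        ¬ IsTypicalDeletion G p t y c.1} =
        {del | ¬ IsTypicalDeletion G p t y del} ×ˢ Set.univ := by ext; simp
    rw [h, measureReal_prod_prod, probReal_univ, mul_one]
    exact not_isTypicalDeletion_le G p ht0 (by linarith)
  have h3 := networkLaw_real_le (r := r) (p := p) (q := q) μ
    (Q := fun G c => ¬ IsTypicalInsertion G q t y c.2) fun G => by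
    have h : {c : (Sym2 (Fin n) → Bool) × (Sym2 (Fin n) → Bool) |
        ¬ IsTypicalInsertion G q t y c.2} =
        Set.univ ×ˢ {ins | ¬ IsTypicalInsertion G q t y ins} := by ext; simp
    rw [h, measureReal_prod_prod, probReal_univ, one_mul]
    exact not_isTypicalInsertion_le G q ht0 (by linarith)
  refine (measureReal_not_and_le h1 (measureReal_not_and_le h2 h3)).trans ?_
  have he := Real.exp_nonneg (-(t * y))
  have hnn : (n : ℝ) * 3 ≤ n ^ 2 := by nlinarith
  nlinarith [mul_le_mul_of_nonneg_right hnn he]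

end Network

/-! ### Comparison of shortest-path metrics -/

section Distance

variable {V : Type*} {G G' : SimpleGraph V} {u v w : V}

theorem edist_le_two_of_common_neighbor (hu : G.Adj u w) (hv : G.Adj v w) : G.edist u v ≤ 2 :=
  (hu.toWalk.append hv.symm.toWalk).edist_le.trans_eq (by simp)

theorem edist_le_mul_edist {c : ℕ} (hc : c ≠ 0) (h : ∀ u v, G'.Adj u v → G.edist u v ≤ c)
    (u v : V) : G.edist u v ≤ c * G'.edist u v := by
  by_cases hr : G'.edist u v = ⊤
  · rw [hr, ENat.mul_top (by exact_mod_cast hc)]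
    exact le_top
  obtain ⟨p, hp⟩ := SimpleGraph.exists_walk_of_edist_ne_top hr
  rw [← hp]
  clear hp hr
  induction p with
  | nil => simp
  | cons hadj p ih =>
    refine SimpleGraph.edist_triangle.trans ((add_le_add (h _ _ hadj) ih).trans_eq ?_)
    rw [SimpleGraph.Walk.length_cons]
    push_cast
    ring

end Distance

/-! ### Jaccard indices in typical outcomes -/

section Deterministic

variable {n : ℕ} {G : SimpleGraph (Fin n)} {del ins : Sym2 (Fin n) → Bool}
  {L s t y p q c τ : ℝ} {u v w : Fin n}

theorem perturb_adj_of_kept (h : G.Adj u v) (hd : del s(u, v) = false) :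
    (perturb G del ins).Adj u v :=
  ⟨h.ne, Or.inl ⟨h, hd⟩⟩

theorem adj_or_inserted_of_perturb_adj (h : (perturb G del ins).Adj u v) :
    G.Adj u v ∨ ins s(u, v) = true :=
  h.2.imp And.left And.right

/-- The Jaccard index of an edge of the true graph is large: its common neighbors are a fixed
proportion of the neighbors, and the inserted neighbors are at most `O(c)` times as many. -/
theorem le_jaccardIndex_of_adj (hG : IsTypicalGraph G L s t y)
    (hdel : IsTypicalDeletion G p t y del) (hins : IsTypicalInsertion G q t y ins)
    (hL : 1 ≤ L) (hsn : 0 < s * n) (ht1 : t ≤ 1 / 100)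
    (hy : y = 5 * t * (s * n)) (hp : p ≤ 1 / 4) (hc : 0 ≤ c) (hq0 : 0 ≤ q) (hq : q ≤ c * s)
    (hτ : τ ≤ (1 - p) ^ 2 / ((10 + 20 * c) * L ^ 2)) (huv : G.Adj u v) :
    τ ≤ jaccardIndex (perturb G del ins) u v := by
  obtain ⟨hK, hU⟩ := hG.edge (u, v) huv
  have hC := hdel.common (u, v) huv.ne
  have hIu := hins.nodes u
  have hIv := hins.nodes v
  set H := perturb G del ins
  have hinter : ({w | w ∈ G.neighborSet u ∩ G.neighborSet v ∧
      del s(u, w) = false ∧ del s(v, w) = false}.ncard : ℝ) ≤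
      ((H.neighborSet u ∩ H.neighborSet v).ncard : ℝ) := by
    gcongr
    · exact Set.toFinite _
    · exact fun w hw => ⟨perturb_adj_of_kept hw.1.1 hw.2.1, perturb_adj_of_kept hw.1.2 hw.2.2⟩
  have hunion : ((H.neighborSet u ∪ H.neighborSet v).ncard : ℝ) ≤
      (G.neighborSet u ∪ G.neighborSet v).ncard +
        ({w | ins s(u, w) = true}.ncard + {w | ins s(v, w) = true}.ncard) := by
    have hsub : H.neighborSet u ∪ H.neighborSet v ⊆ (G.neighborSet u ∪ G.neighborSet v) ∪
        ({w | ins s(u, w) = true} ∪ {w | ins s(v, w) = true}) := by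
      rintro w (hw | hw)
      · rcases adj_or_inserted_of_perturb_adj hw with h | h
        · exact Or.inl (Or.inl h)
        · exact Or.inr (Or.inl h)
      · rcases adj_or_inserted_of_perturb_adj hw with h | h
        · exact Or.inl (Or.inr h)
        · exact Or.inr (Or.inr h)
    exact_mod_cast (Set.ncard_le_ncard hsub (Set.toFinite _)).trans
      ((Set.ncard_union_le _ _).trans (Nat.add_le_add_left (Set.ncard_union_le _ _) _))
  have hle : ((H.neighborSet u ∩ H.neighborSet v).ncard : ℝ) ≤
      ((H.neighborSet u ∪ H.neighborSet v).ncard : ℝ) := by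
    gcongr
    · exact Set.toFinite _
    · exact fun w hw => Or.inl hw.1
  rw [jaccardIndex]
  dsimp only at hK hU hC
  generalize ((G.neighborSet u ∩ G.neighborSet v).ncard : ℝ) = K at *
  generalize ((G.neighborSet u ∪ G.neighborSet v).ncard : ℝ) = U at *
  generalize ((H.neighborSet u ∩ H.neighborSet v).ncard : ℝ) = K' at *
  generalize ((H.neighborSet u ∪ H.neighborSet v).ncard : ℝ) = U' at *
  generalize ({w | ins s(u, w) = true}.ncard : ℝ) = I₁ at *
  generalize ({w | ins s(v, w) = true}.ncard : ℝ) = I₂ at *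
  have hK0 : 0 < K := by linarith
  have hL2 : 1 ≤ L ^ 2 := one_le_pow₀ hL
  have hy' : y ≤ 67 / 1000 * K := by
    rw [hy]
    nlinarith
  have hP : 9 / 16 ≤ (1 - p) ^ 2 := by nlinarith
  have hK' : 8 / 10 * ((1 - p) ^ 2 * K) < K' := by
    have e1 : 9 / 16 * K ≤ (1 - p) ^ 2 * K := mul_le_mul_of_nonneg_right hP hK0.le
    have e2 : 99 / 100 * (K * (1 - p) ^ 2) ≤ (1 - t) * (K * (1 - p) ^ 2) :=
      mul_le_mul_of_nonneg_right (by linarith) (by positivity)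
    linarith
  have hnq : n * q ≤ 4 / 3 * (c * K) := by
    have e1 : q * n ≤ c * s * n := mul_le_mul_of_nonneg_right hq (Nat.cast_nonneg n)
    have e2 := mul_le_mul_of_nonneg_left hK hc
    linarith
  have hU' : U' ≤ 8 / 10 * ((10 + 20 * c) * L ^ 2 * K) := by
    have e1 : (1 + t) * (n * q) ≤ 101 / 100 * (4 / 3 * (c * K)) :=
      mul_le_mul (by linarith) hnq (by positivity) (by norm_num)
    have hcK : 0 ≤ c * K := by positivity
    have e2 : K ≤ L ^ 2 * K := le_mul_of_one_le_left hK0.le hL2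
    have e3 : c * K ≤ L ^ 2 * (c * K) := le_mul_of_one_le_left hcK hL2
    linarith
  have hU'0 : 0 < U' := by
    have : 0 < (1 - p) ^ 2 * K := by positivity
    linarith
  rw [le_div_iff₀ hU'0]
  have hD : 0 < (10 + 20 * c) * L ^ 2 := by positivity
  calc τ * U' ≤ (1 - p) ^ 2 / ((10 + 20 * c) * L ^ 2) * U' :=
        mul_le_mul_of_nonneg_right hτ hU'0.le
    _ ≤ (1 - p) ^ 2 / ((10 + 20 * c) * L ^ 2) * (8 / 10 * ((10 + 20 * c) * L ^ 2 * K)) :=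
        mul_le_mul_of_nonneg_left hU' (by positivity)
    _ = 8 / 10 * ((1 - p) ^ 2 * K) := by field_simp
    _ ≤ K' := hK'.le

/-- The number of such nodes is at least about `(1 - p) ^ 2 * K > 0`, with `K` the number of common
neighbors in the true graph. -/
theorem exists_kept_common_neighbor (hG : IsTypicalGraph G L s t y)
    (hdel : IsTypicalDeletion G p t y del) (hsn : 0 < s * n) (ht1 : t ≤ 1 / 100)
    (hy : y = 5 * t * (s * n)) (hp : p ≤ 1 / 4) (huv : G.Adj u v) :
    ∃ w, G.Adj u w ∧ G.Adj v w ∧ del s(u, w) = false ∧ del s(v, w) = false := by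
  have hK := (hG.edge (u, v) huv).1
  have hC := hdel.common (u, v) huv.ne
  dsimp only at hK hC
  have hP : 9 / 16 ≤ (1 - p) ^ 2 := by nlinarith
  have hpos : (0 : ℝ) < {w | w ∈ G.neighborSet u ∩ G.neighborSet v ∧
      del s(u, w) = false ∧ del s(v, w) = false}.ncard := by
    refine lt_of_le_of_lt ?_ hC
    generalize ((G.neighborSet u ∩ G.neighborSet v).ncard : ℝ) = K at *
    have hK0 : 0 < K := by linarith
    have e1 : 9 / 16 * K ≤ (1 - p) ^ 2 * K := mul_le_mul_of_nonneg_right hP hK0.le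
    have e2 : 99 / 100 * (K * (1 - p) ^ 2) ≤ (1 - t) * (K * (1 - p) ^ 2) :=
      mul_le_mul_of_nonneg_right (by linarith) (by positivity)
    have hy' : y ≤ 67 / 1000 * K := by
      rw [hy]
      nlinarith
    linarith
  obtain ⟨w, hw⟩ := Set.nonempty_of_ncard_ne_zero (by exact_mod_cast hpos.ne')
  exact ⟨w, hw.1.1, hw.1.2, hw.2.1, hw.2.2⟩

/-- The ratio of the number `K'` of common neighbors to the number `U'` of neighbors of two nodes of
degrees `a` and `b` whose neighbor sets in the true graph are disjoint. -/
theorem div_lt_of_far_counts {a b K' U' : ℝ} (hs0 : 0 < s) (hn : (1000 : ℝ) ≤ n) (ht0 : 0 ≤ t)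
    (ht1 : t ≤ 1 / 100) (hy : y = 5 * t * (s * n)) (hp : p ≤ 1 / 4) (hc : 0 ≤ c) (hq0 : 0 ≤ q)
    (hq : q ≤ c * s) (hτ : (c + 2) * q / (1 - p) + 20 * t < τ)
    (ha : (1 - t) * ((n - 1) * s) - y < a) (hb : (1 - t) * ((n - 1) * s) - y < b)
    (hU' : (1 - t) * (a * (1 - p)) - y + ((1 - t) * (b * (1 - p)) - y) < U')
    (hK' : K' < (1 + t) * (a * q) + y + ((1 + t) * (b * q) + y + ((1 + t) * (n * q ^ 2) + y))) :
    K' / U' < τ := by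
  have hsn : 0 < s * n := by positivity
  have hA : 18 / 10 * (s * n) ≤ a + b := by
    have e0 : (1000 : ℝ) * s ≤ n * s := mul_le_mul_of_nonneg_right hn hs0.le
    have e1 : 999 / 1000 * (s * n) ≤ (n - 1) * s := by linarith
    have e2 : 99 / 100 * ((n - 1) * s) ≤ (1 - t) * ((n - 1) * s) :=
      mul_le_mul_of_nonneg_right (by linarith) (by linarith)
    have e3 : t * (s * n) ≤ 1 / 100 * (s * n) := mul_le_mul_of_nonneg_right ht1 hsn.le
    linarith
  have hA0 : 0 < a + b := by linarith
  have hy' : y ≤ 28 / 10 * (t * (a + b)) := by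
    have e1 := mul_le_mul_of_nonneg_left hA ht0
    have e2 : 0 ≤ t * (a + b) := by positivity
    linarith
  have hp1 : 0 < 1 - p := by linarith
  have htA : 0 ≤ t * (a + b) := by positivity
  have hden : 91 / 100 * ((a + b) * (1 - p)) ≤ U' := by
    have e1 : t * (a + b) * (3 / 4) ≤ t * (a + b) * (1 - p) :=
      mul_le_mul_of_nonneg_left (by linarith) htA
    have e2 : t * ((a + b) * (1 - p)) ≤ 1 / 100 * ((a + b) * (1 - p)) :=
      mul_le_mul_of_nonneg_right ht1 (by positivity)
    linarith
  have f1 : 0 ≤ (a + b) * q := by positivity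
  have f2 : 0 ≤ q * c * (a + b) := by positivity
  -- The coefficient of `c` is `5 / 9` as `s * n ≤ 5 / 9 * (a + b)`. That it stays below `1`, and
  -- the coefficient `1` of `q` below `2`, absorbs the relative errors; `20 * t` absorbs the
  -- additive ones.
  have hnum : K' < 101 / 100 * ((a + b) * q + 5 / 9 * (q * c * (a + b))) +
      84 / 10 * (t * (a + b)) := by
    have e1 : n * q ^ 2 ≤ 5 / 9 * (q * c * (a + b)) := by
      have g1 : q * (q * n) ≤ q * (c * s * n) :=
        mul_le_mul_of_nonneg_left (mul_le_mul_of_nonneg_right hq (Nat.cast_nonneg n)) hq0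
      have g2 := mul_le_mul_of_nonneg_left hA (mul_nonneg hq0 hc)
      linarith
    have e2 : (1 + t) * ((a + b) * q + n * q ^ 2) ≤
        101 / 100 * ((a + b) * q + 5 / 9 * (q * c * (a + b))) :=
      mul_le_mul (by linarith) (by linarith) (by positivity) (by norm_num)
    linarith
  have hU'0 : 0 < U' := lt_of_lt_of_le (by positivity) hden
  rw [div_lt_iff₀ hU'0]
  calc K' < 101 / 100 * ((a + b) * q + 5 / 9 * (q * c * (a + b))) + 84 / 10 * (t * (a + b)) := hnum
    _ ≤ 91 / 100 * ((a + b) * ((c + 2) * q + 15 * t)) := by linarith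
    _ ≤ 91 / 100 * ((a + b) * ((c + 2) * q + 20 * t * (1 - p))) := by
        have g : t * (3 / 4) ≤ t * (1 - p) := mul_le_mul_of_nonneg_left (by linarith) ht0
        linarith [mul_le_mul_of_nonneg_left g hA0.le]
    _ = ((c + 2) * q / (1 - p) + 20 * t) * (91 / 100 * ((a + b) * (1 - p))) := by
        field_simp
    _ ≤ ((c + 2) * q / (1 - p) + 20 * t) * U' := mul_le_mul_of_nonneg_left hden (by positivity)
    _ ≤ τ * U' := mul_le_mul_of_nonneg_right hτ.le hU'0.le

/-- The Jaccard index of two nodes at distance at least `3` in the true graph is small: all their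
common neighbors come from insertions. -/
theorem jaccardIndex_lt_of_far (hG : IsTypicalGraph G L s t y)
    (hdel : IsTypicalDeletion G p t y del) (hins : IsTypicalInsertion G q t y ins)
    (hs0 : 0 < s) (hn : (1000 : ℝ) ≤ n) (ht0 : 0 ≤ t) (ht1 : t ≤ 1 / 100)
    (hy : y = 5 * t * (s * n)) (hp : p ≤ 1 / 4) (hc : 0 ≤ c) (hq0 : 0 ≤ q) (hq : q ≤ c * s)
    (hτ : (c + 2) * q / (1 - p) + 20 * t < τ) (huv : u ≠ v)
    (hfar : ∀ w, G.Adj u w → ¬ G.Adj v w) :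
    jaccardIndex (perturb G del ins) u v < τ := by
  have ha := hG.degree u
  have hb := hG.degree v
  have hau := hdel.neighbors u
  have hbv := hdel.neighbors v
  have h₁ := hins.neighbors (u, v)
  have h₂ := hins.neighbors (v, u)
  have h₃ := hins.common (u, v) huv
  set H := perturb G del ins
  have hinter : ((H.neighborSet u ∩ H.neighborSet v).ncard : ℝ) ≤
      {w | w ∈ G.neighborSet u ∧ ins s(v, w) = true}.ncard +
      ({w | w ∈ G.neighborSet v ∧ ins s(u, w) = true}.ncard +
      {w | (w ≠ u ∧ w ≠ v) ∧ ins s(u, w) = true ∧ ins s(v, w) = true}.ncard) := by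
    have hsub : H.neighborSet u ∩ H.neighborSet v ⊆
        {w | w ∈ G.neighborSet u ∧ ins s(v, w) = true} ∪
        ({w | w ∈ G.neighborSet v ∧ ins s(u, w) = true} ∪
        {w | (w ≠ u ∧ w ≠ v) ∧ ins s(u, w) = true ∧ ins s(v, w) = true}) := by
      rintro w ⟨hwu, hwv⟩
      rcases adj_or_inserted_of_perturb_adj hwu with h | h <;>
        rcases adj_or_inserted_of_perturb_adj hwv with h' | h'
      · exact absurd h' (hfar w h)
      · exact Or.inl ⟨h, h'⟩
      · exact Or.inr (Or.inl ⟨h', h⟩)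
      · exact Or.inr (Or.inr ⟨⟨hwu.1.symm, hwv.1.symm⟩, h, h'⟩)
    exact_mod_cast (Set.ncard_le_ncard hsub (Set.toFinite _)).trans
      ((Set.ncard_union_le _ _).trans (Nat.add_le_add_left (Set.ncard_union_le _ _) _))
  have hunion : ({w | w ∈ G.neighborSet u ∧ del s(u, w) = false}.ncard : ℝ) +
      {w | w ∈ G.neighborSet v ∧ del s(v, w) = false}.ncard ≤
      (H.neighborSet u ∪ H.neighborSet v).ncard := by
    have hdisj : Disjoint {w | w ∈ G.neighborSet u ∧ del s(u, w) = false}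
        {w | w ∈ G.neighborSet v ∧ del s(v, w) = false} :=
      Set.disjoint_left.2 fun w h h' => hfar w h.1 h'.1
    have hsub : {w | w ∈ G.neighborSet u ∧ del s(u, w) = false} ∪
        {w | w ∈ G.neighborSet v ∧ del s(v, w) = false} ⊆ H.neighborSet u ∪ H.neighborSet v :=
      Set.union_subset_union (fun w hw => perturb_adj_of_kept hw.1 hw.2)
        fun w hw => perturb_adj_of_kept hw.1 hw.2
    have := Set.ncard_le_ncard hsub (Set.toFinite _)
    rw [Set.ncard_union_eq hdisj (Set.toFinite _) (Set.toFinite _)] at this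
    exact_mod_cast this
  rw [jaccardIndex]
  dsimp only at h₁ h₂ h₃
  generalize ((H.neighborSet u ∩ H.neighborSet v).ncard : ℝ) = K' at *
  generalize ((H.neighborSet u ∪ H.neighborSet v).ncard : ℝ) = U' at *
  generalize ((G.neighborSet u).ncard : ℝ) = a at *
  generalize ((G.neighborSet v).ncard : ℝ) = b at *
  exact div_lt_of_far_counts hs0 hn ht0 ht1 hy hp hc hq0 hq hτ ha hb
    ((add_lt_add hau hbv).trans_le hunion)
    (hinter.trans_lt (add_lt_add h₁ (add_lt_add h₂ h₃)))

theorem isApproximation_jaccardFilter (hG : IsTypicalGraph G L s t y)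
    (hdel : IsTypicalDeletion G p t y del) (hins : IsTypicalInsertion G q t y ins)
    (hL : 1 ≤ L) (hs0 : 0 < s) (hn : (1000 : ℝ) ≤ n) (ht0 : 0 ≤ t) (ht1 : t ≤ 1 / 100)
    (hy : y = 5 * t * (s * n)) (hp : p ≤ 1 / 4) (hc : 0 ≤ c) (hq0 : 0 ≤ q) (hq : q ≤ c * s)
    (hτ₁ : (c + 2) * q / (1 - p) + 20 * t < τ)
    (hτ₂ : τ ≤ (1 - p) ^ 2 / ((10 + 20 * c) * L ^ 2)) :
    IsApproximation 2 (jaccardFilter τ (perturb G del ins)) G := by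
  have hsn : 0 < s * n := by positivity
  refine fun u v => ⟨edist_le_mul_edist two_ne_zero (fun u v huv => ?_) u v,
    edist_le_mul_edist two_ne_zero (fun u v huv => ?_) u v⟩
  · by_cases hcommon : ∃ w, G.Adj u w ∧ G.Adj v w
    · obtain ⟨w, hu, hv⟩ := hcommon
      exact edist_le_two_of_common_neighbor hu hv
    · push Not at hcommon
      exact absurd huv.2 (jaccardIndex_lt_of_far hG hdel hins hs0 hn ht0 ht1 hy hp hc hq0 hq hτ₁
        huv.1.ne hcommon).not_ge
  · obtain ⟨w, hu, hv, hdu, hdv⟩ := exists_kept_common_neighbor hG hdel hsn ht1 hy hp huv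
    exact edist_le_two_of_common_neighbor (w := w)
      ⟨perturb_adj_of_kept hu hdu, le_jaccardIndex_of_adj hG hdel hins hL hsn ht1 hy hp hc hq0
        hq hτ₂ hu⟩
      ⟨perturb_adj_of_kept hv hdv, le_jaccardIndex_of_adj hG hdel hins hL hsn ht1 hy hp hc hq0
        hq hτ₂ hv⟩

end Deterministic

end JaccardFiltering

end

theorem theorem4p5 :
    -- `κ` is the constant in "with probability at least `1 - n ^ (-Ω(1))`"
    ∃ κ : ℝ, 0 < κ ∧
    -- the lower bounds `s n` on the ball measures, with `s n * n = ω(ln n)`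
    ∀ s : ℕ → ℝ, Tendsto (fun n : ℕ => s n * n / Real.log n) atTop atTop →
    -- the `o(1)` term, chosen before everything else
    ∃ ε : ℕ → ℝ, Tendsto ε atTop (𝓝 0) ∧
    ∀ᶠ n : ℕ in atTop,
    ∀ (X : Type*) [MetricSpace X] [CompactSpace X] [MeasurableSpace X] [BorelSpace X]
      (μ : Measure X) [IsProbabilityMeasure μ] (L r c τ : ℝ) (p q : unitInterval),
      JaccardFiltering.IsGeodesicSpace X →
      JaccardFiltering.IsDoublingMeasure μ L →
      0 < r →
      JaccardFiltering.AssumptionR μ r n (s n) →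
      (p : ℝ) ≤ 1 / 4 →
      (q : ℝ) ≤ min (1 / 8) (c * s n) →
      (c + 2) * q / (1 - p) + ε n < τ →
      τ < (1 - (p : ℝ)) ^ 2 / ((10 + 5 / (3 * Real.log n) + 20 * c) * L ^ 2) →
      1 - (n : ℝ) ^ (-κ) ≤
        (JaccardFiltering.networkLaw μ n p q).real
          {ω | JaccardFiltering.IsApproximation 2
            (JaccardFiltering.jaccardFilter τ (JaccardFiltering.observedGraph r ω))
            (JaccardFiltering.trueGraph r ω)} := by
  refine ⟨1, one_pos, fun s hs => ?_⟩
  -- The relative deviation `t n` satisfies `t n ^ 2 * (s n * n) = log n`, so that the Chernoff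
  -- bound `exp (-(t n * y))` with `y = 5 * t n * (s n * n)` is `n ^ (-5)`, while `y = o(s n * n)`.
  set t : ℕ → ℝ := fun n => √(s n * n / Real.log n)⁻¹ with ht
  have htt : Tendsto t atTop (𝓝 0) := by
    simpa only [Real.sqrt_zero, Function.comp_def] using (tendsto_inv_atTop_zero.comp hs).sqrt
  refine ⟨fun n => 20 * t n, by simpa using htt.const_mul 20, ?_⟩
  filter_upwards [hs.eventually_ge_atTop 1000, eventually_ge_atTop 1000,
    htt.eventually_le_const (show (0 : ℝ) < 1 / 100 by norm_num)] with n hsn hn ht1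
  intro X _ _ _ _ μ _ L r c τ p q hX hμ hr hR hp hq hτ₁ hτ₂
  have hn' : (1000 : ℝ) ≤ n := by exact_mod_cast hn
  have hlog : 1 ≤ Real.log n := by
    rw [Real.le_log_iff_exp_le (by linarith)]
    linarith [Real.exp_one_lt_d9]
  have hsn' : 1000 ≤ s n * n := by
    rw [le_div_iff₀ (by linarith)] at hsn
    nlinarith
  have hs0 : 0 < s n := pos_of_mul_pos_left (by linarith) (by linarith : (0 : ℝ) ≤ n)
  have ht0 : 0 ≤ t n := Real.sqrt_nonneg _
  have hq0 : (0 : ℝ) ≤ q := q.2.1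
  have hqc : (q : ℝ) ≤ c * s n := hq.trans (min_le_right _ _)
  have hc : 0 ≤ c := nonneg_of_mul_nonneg_left (hq0.trans hqc) hs0
  have hne : Nonempty X := μ.nonempty_of_neZero
  have hL : 1 ≤ L := hμ.one_le
  have hτ₂' : τ ≤ (1 - (p : ℝ)) ^ 2 / ((10 + 20 * c) * L ^ 2) := by
    refine hτ₂.le.trans ?_
    have : 0 ≤ 5 / (3 * Real.log n) := by positivity
    gcongr
    linarith
  have hbad := JaccardFiltering.networkLaw_not_typical_le (p := p) (q := q) (n := n) (t := t n) μ
    hX hμ hr hs0 hR.le_measure_ball hn' hsn' ht0 ht1 rfl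
  have hexp : Real.exp (-(t n * (5 * t n * (s n * n)))) = ((n : ℝ) ^ 5)⁻¹ := by
    have h1 : t n ^ 2 = Real.log n / (s n * n) := by
      rw [ht, Real.sq_sqrt (by positivity), inv_div]
    have h2 : t n * (5 * t n * (s n * n)) = 5 * Real.log n := by
      calc t n * (5 * t n * (s n * n)) = 5 * (t n ^ 2 * (s n * n)) := by ring
        _ = 5 * Real.log n := by rw [h1, div_mul_cancel₀ _ (by linarith)]
    rw [h2, Real.exp_neg, ← Nat.cast_ofNat (R := ℝ), Real.exp_nat_mul, Real.exp_log (by linarith)]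
  have hfail : 6 * (n : ℝ) ^ 2 * ((n : ℝ) ^ 5)⁻¹ ≤ (n : ℝ) ^ (-1 : ℝ) := by
    rw [Real.rpow_neg_one, ← div_eq_mul_inv, div_le_iff₀ (by positivity)]
    have h1 : (n : ℝ)⁻¹ * n ^ 5 = n ^ 2 * n ^ 2 := by field_simp
    rw [h1]
    gcongr
    nlinarith
  rw [hexp] at hbad
  refine (sub_le_sub_left hfail 1).trans (JaccardFiltering.one_sub_le_measureReal ?_ hbad)
  rintro ω ⟨hG, hdel, hins⟩
  exact JaccardFiltering.isApproximation_jaccardFilter hG hdel hins hL hs0 hn' ht0 ht1 rfl hp hc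
    hq0 hqc hτ₁ hτ₂'
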